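/- Let $(\mathsf D,\mathfrak m)$ be a finite measure space and $\mathbb H:=L^2(\mathsf D,\mathfrak m)$ (real-valued), with norm $|\cdot|$. Let $\mathbb V$ be a real Hilbert space that is densely and compactly embedded in $\mathbb H$, and let $\mathcal E:\mathbb V\times\mathbb V\to\mathbb R$ be a continuous symmetric bilinear form such that, for constants $\alpha\ge 0$ and $M>0$, $$\mathcal E(u,u)\ge\alpha|u|^2,\qquad M^{-1}\|u\|_{\mathbb V}^2\le \mathcal E(u,u)+|u|^2\le M\|u\|_{\mathbb V}^2\qquad\text{for every }u\in\mathbb V .$$ Let $\mathbb K\subset\mathbb H$ be a convex set and $V_{\min}\in\mathbb R$ a constant such that $V\ge V_{\min}$ $\mathfrak m$-a.e. for every $V\in\mathbb K$; put $\lambda_{\min}:=\alpha+V_{\min}$. For $V\in\mathbb K$ let $$\mathcal E_V(u,v):=\mathcal E(u,v)+\int_{\mathsf D}V\,u\,v\,d\mathfrak m,\qquad D(\mathcal E_V):=\Big\{u\in\mathbb V:\int_{\mathsf D}V_+u^2\,d\mathfrak m<+\infty\Big\},\qquad \mathcal E_V(u):=\mathcal E_V(u,u).$$ A real number $\lambda$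 is an eigenvalue of $\mathcal E_V$, with eigenfunction $u\in D(\mathcal E_V)\setminus\{0\}$, if $\mathcal E_V(u,v)=\lambda\int_{\mathsf D}uv\,d\mathfrak m$ for every $v\in D(\mathcal E_V)$. Assume that, for every $V\in\mathbb K$, every eigenfunction of $\mathcal E_V$ belongs to $L^4(\mathsf D,\mathfrak m)$. Let $k\in\mathbb N$ and suppose that $\dim D(\mathcal E_V)\ge k$ for every $V\in\mathbb K$. Denote by $\boldsymbol\lambda^k(V)=(\lambda_1(V)\le\dots\le\lambda_k(V))$ the first $k$ eigenvalues of $\mathcal E_V$, repeated according to multiplicity. Let $\phi\in C^1([\lambda_{\min},+\infty)^k)$ be symmetric, increasing (that is, nondecreasing in each variable) and Schur-concave, i.e. $$\big(\partial_i\phi(\boldsymbol\lambda)-\partial_j\phi(\boldsymbol\lambda)\big)(\lambda_i-\lambda_j)\le 0\qquad\text{for every }\boldsymbol\lambda\in[\lambda_{\min},+\infty)^k\text{ and all } i,j,$$ and set $\mathscr H(V):=\phi(\boldsymbol\lambda^k(V))$ for $V\in\mathbb K$. Then for every $V\in\mathbb K$ $$\mathscr H(V)=\min\Big\{\phi\big(\mathcal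 E_V(w_1),\dots,\mathcal E_V(w_k)\big):\ w_1,\dots,w_k\in\mathbb V\cap L^4(\mathsf D,\mathfrak m)\text{ orthonormal in }\mathbb H\Big\},$$ the minimum being attained. If moreover $\phi$ is concave on $[\lambda_{\min},+\infty)^k$, then $\mathscr H$ is concave on $\mathbb K$. -/

import Mathlib

open MeasureTheory

noncomputable section

namespace SchrodingerPotential

variable {D : Type*} [MeasurableSpace D] {m : Measure D}
  {𝕍 : Type*} [NormedAddCommGroup 𝕍] [InnerProductSpace ℝ 𝕍]

/-- `E_V(u, v) = E(u, v) + ∫ V u v dm`, where the Hilbert space `𝕍` is regarded as a subspace of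
`L²(D, m)` through the embedding `ι`. -/
def form (ι : 𝕍 →L[ℝ] Lp ℝ 2 m) (E : 𝕍 →L[ℝ] 𝕍 →L[ℝ] ℝ) (V : Lp ℝ 2 m) (u v : 𝕍) : ℝ :=
  E u v + ∫ x, V x * ι u x * ι v x ∂m

/-- The domain `D(E_V) = {u ∈ 𝕍 : ∫ V₊ u² dm < +∞}`. -/
def formDomain (ι : 𝕍 →L[ℝ] Lp ℝ 2 m) (V : Lp ℝ 2 m) : Set 𝕍 :=
  {u | Integrable (fun x => max (V x) 0 * (ι u x) ^ 2) m}

/-- `u` is a `(V, μ)`-eigenfunction: a nonzero element of `D(E_V)` such that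
`E(u, v) + ∫ V u v dm = μ ∫ u v dm` for every `v ∈ D(E_V)`. -/
def IsEigenfunction (ι : 𝕍 →L[ℝ] Lp ℝ 2 m) (E : 𝕍 →L[ℝ] 𝕍 →L[ℝ] ℝ) (V : Lp ℝ 2 m)
    (μ : ℝ) (u : 𝕍) : Prop :=
  u ∈ formDomain ι V ∧ u ≠ 0 ∧
    ∀ v ∈ formDomain ι V, form ι E V u v = μ * ∫ x, ι u x * ι v x ∂m

/-- The span of all the eigenfunctions of `E_V` whose eigenvalue is at most `t`; its dimension is
the number of eigenvalues `≤ t`, counted with multiplicity. -/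
def eigenspaceLE (ι : 𝕍 →L[ℝ] Lp ℝ 2 m) (E : 𝕍 →L[ℝ] 𝕍 →L[ℝ] ℝ) (V : Lp ℝ 2 m) (t : ℝ) :
    Submodule ℝ 𝕍 :=
  Submodule.span ℝ {u | ∃ μ ≤ t, IsEigenfunction ι E V μ u}

/-- The eigenvalues of `E_V` in nondecreasing order, repeated according to multiplicity:
`eigenvalue ι E V j` is the `(j + 1)`-st eigenvalue (the index `j` starts from `0`), that is, the
least `t` such that at least `j + 1` eigenvalues, counted with multiplicity, are `≤ t`. -/
def eigenvalue (ι : 𝕍 →L[ℝ] Lp ℝ 2 m) (E : 𝕍 →L[ℝ] 𝕍 →L[ℝ] ℝ) (V : Lp ℝ 2 m) (j : ℕ) : ℝ :=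
  sInf {t : ℝ | ((j + 1 : ℕ) : Cardinal) ≤ Module.rank ℝ (eigenspaceLE ι E V t)}

/-- `H(V) = φ(λ₁(V), …, λ_k(V))`. -/
def spectralFunctional (ι : 𝕍 →L[ℝ] Lp ℝ 2 m) (E : 𝕍 →L[ℝ] 𝕍 →L[ℝ] ℝ) {k : ℕ}
    (φ : (Fin k → ℝ) → ℝ) (V : Lp ℝ 2 m) : ℝ :=
  φ (fun j => eigenvalue ι E V j)

/-- The orthant `[a, +∞)^k`. -/
def orthant (k : ℕ) (a : ℝ) : Set (Fin k → ℝ) := {x | ∀ i, a ≤ x i}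

/-- `φ` is symmetric on `[a, +∞)^k`. -/
def IsSymmetricOn {k : ℕ} (φ : (Fin k → ℝ) → ℝ) (a : ℝ) : Prop :=
  ∀ σ : Equiv.Perm (Fin k), ∀ x ∈ orthant k a, φ (x ∘ σ) = φ x

/-- The partial derivative `∂ᵢφ(x)` of a function of class `C¹` on `[a, +∞)^k` (the derivative
relative to the orthant, one-sided at the boundary). -/
def partialDeriv {k : ℕ} (φ : (Fin k → ℝ) → ℝ) (a : ℝ) (i : Fin k) (x : Fin k → ℝ) : ℝ :=
  fderivWithin ℝ φ (orthant k a) x (Pi.single i 1)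

/-- Schur-concavity of a `C¹` function on `[a, +∞)^k`: `(∂ᵢφ(x) - ∂ⱼφ(x)) (xᵢ - xⱼ) ≤ 0`. For
symmetric `φ` it is the same to ask for this for only one pair of indices `i ≠ j`. -/
def IsSchurConcaveOn {k : ℕ} (φ : (Fin k → ℝ) → ℝ) (a : ℝ) : Prop :=
  ∀ x ∈ orthant k a, ∀ i j : Fin k,
    (partialDeriv φ a i x - partialDeriv φ a j x) * (x i - x j) ≤ 0

end SchrodingerPotential

end

/-! Fix `V` and minimize the Rayleigh quotient of `E_V` successively, each time orthogonally to the
previous minimizers. The compact embedding and the lower bound on `V` make every minimum attained;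
the minimizers are orthonormal eigenfunctions, and the minima are the eigenvalues with multiplicity
(`eigenvalue_eq`). The eigenfunctions lie in `L⁴`, so they are competitors, and they realize the
value `φ(λ₁, …, λ_k)`.

For an arbitrary competitor `w`, sort the energies `E_V(w_i)` into a nondecreasing vector `x`; by
symmetry `φ` does not see the sorting. Ky Fan's inequality (`sum_minimum_le`), applied to the `p`
members of lowest energy, bounds the sum of the first `p` eigenvalues by the sum of the first `p`
entries of `x`, for every `p ≤ k`. On the segment from the eigenvalues to `x` all vectors are
nondecreasing. There Schur-concavity and symmetry order the partial derivatives of `φ` decreasingly,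
monotonicity makes them nonnegative, and Abel summation shows that `φ` increases along the segment
(`le_of_partial_sums_le`).

For concavity, the `L⁴` condition makes the class of competitors independent of `V`, and for fixed
`w` the energies are affine in `V`. Hence `H` is an infimum of compositions of a concave function
with affine maps. -/

namespace SchrodingerPotential

/-! ### Successive minimizers of a symmetric bilinear form and Ky Fan's inequality. -/

section Abstract

open scoped InnerProductSpace

variable {W H : Type*} [AddCommGroup W] [Module ℝ W] [NormedAddCommGroup H]
  [InnerProductSpace ℝ H] (j : W →ₗ[ℝ] H) (B : W →ₗ[ℝ] W →ₗ[ℝ] ℝ)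

/-- `v` minimizes the Rayleigh quotient of `B` on the vectors orthogonal to `u 0, …, u (n - 1)`. -/
structure IsMinimizer (u : ℕ → W) (n : ℕ) (v : W) : Prop where
  norm_eq : ‖j v‖ = 1
  orth : ∀ l < n, ⟪j (u l), j v⟫_ℝ = 0
  le : ∀ w, (∀ l < n, ⟪j (u l), j w⟫_ℝ = 0) → B v v * ‖j w‖ ^ 2 ≤ B w w

variable {j B}

theorem IsMinimizer.congr {u u' : ℕ → W} {n : ℕ} {v : W} (h : IsMinimizer j B u n v)
    (huu' : ∀ l < n, u' l = u l) : IsMinimizer j B u' n v where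
  norm_eq := h.norm_eq
  orth l hl := by rw [huu' l hl]; exact h.orth l hl
  le w hw := h.le w fun l hl => by rw [← huu' l hl]; exact hw l hl

/-- Being the minimizer of stage `n` depends only on the entries below `n`, so the sequence can be
built one entry at a time; entries beyond the current stage are junk. -/
theorem exists_minimizers {k : ℕ}
    (hmin : ∀ (u : ℕ → W), ∀ n < k, ∃ v, IsMinimizer j B u n v) :
    ∀ n ≤ k, ∃ u : ℕ → W, ∀ i < n, IsMinimizer j B u i (u i) := by
  intro n
  induction n with
  | zero => exact fun _ => ⟨0, fun i hi => absurd hi (Nat.not_lt_zero i)⟩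
  | succ n ih =>
    intro hn
    obtain ⟨u, hu⟩ := ih (by omega)
    obtain ⟨v, hv⟩ := hmin u n (by omega)
    refine ⟨Function.update u n v, fun i hi => ?_⟩
    rcases Nat.lt_succ_iff_lt_or_eq.1 hi with hi | rfl
    · rw [Function.update_of_ne hi.ne]
      exact (hu i hi).congr fun l hl => Function.update_of_ne (by omega) _ _
    · rw [Function.update_self]
      exact hv.congr fun l hl => Function.update_of_ne (by omega) _ _

theorem inner_eq_ite {u : ℕ → W} {n : ℕ} (hu : ∀ i < n, IsMinimizer j B u i (u i)) {i l : ℕ}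
    (hi : i < n) (hl : l < n) : ⟪j (u i), j (u l)⟫_ℝ = if i = l then 1 else 0 := by
  rcases lt_trichotomy i l with h | rfl | h
  · rw [if_neg h.ne, (hu l hl).orth i h]
  · rw [if_pos rfl, real_inner_self_eq_norm_sq, (hu i hi).norm_eq, one_pow]
  · rw [if_neg h.ne', real_inner_comm, (hu i hi).orth l h]

theorem inner_sub_sum_eq_zero {u : ℕ → W} {n : ℕ} (hu : ∀ i < n, IsMinimizer j B u i (u i)) (w : W)
    {l : ℕ} (hl : l < n) :
    ⟪j (u l), j (w - ∑ i ∈ Finset.range n, ⟪j (u i), j w⟫_ℝ • u i)⟫_ℝ = 0 := by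
  rw [map_sub, map_sum, inner_sub_right, inner_sum, Finset.sum_eq_single_of_mem l (by simpa using hl)]
  · rw [map_smul, inner_smul_right, inner_eq_ite hu hl hl]; simp
  · intro i hi hil
    rw [map_smul, inner_smul_right, inner_eq_ite hu hl (by simpa using hi), if_neg hil.symm, mul_zero]

/-- The Euler–Lagrange equation of a constrained minimizer. -/
theorem IsMinimizer.apply_eq_of_orth (hB : ∀ x y, B x y = B y x) {u : ℕ → W} {n : ℕ} {v : W}
    (h : IsMinimizer j B u n v) {w : W} (hw : ∀ l < n, ⟪j (u l), j w⟫_ℝ = 0) :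
    B v w = B v v * ⟪j v, j w⟫_ℝ := by
  set c := B v w - B v v * ⟪j v, j w⟫_ℝ with hc
  set d := B w w - B v v * ‖j w‖ ^ 2 with hd
  have key : ∀ t : ℝ, 0 ≤ 2 * t * c + t ^ 2 * d := by
    intro t
    have h1 := h.le (v + t • w) fun l hl => by
      rw [map_add, map_smul, inner_add_right, inner_smul_right, h.orth l hl, hw l hl]; simp
    rw [map_add, map_smul, norm_add_sq_real, h.norm_eq, inner_smul_right, norm_smul, mul_pow,
      Real.norm_eq_abs, sq_abs] at h1
    simp only [map_add, map_smul, LinearMap.add_apply, LinearMap.smul_apply, smul_eq_mul,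
      hB w v] at h1
    rw [hc, hd]
    linarith
  have hd0 : 0 ≤ d := sub_nonneg.2 (h.le w hw)
  -- The quadratic is minimal at `-c / d`; the denominator `d + 1` avoids the case `d = 0` and still
  -- makes the value negative unless `c = 0`.
  have h2 := key (-c / (d + 1))
  have h3 : 2 * (-c / (d + 1)) * c + (-c / (d + 1)) ^ 2 * d = -(c ^ 2 * (d + 2)) / (d + 1) ^ 2 := by
    field_simp; ring
  rw [h3, le_div_iff₀ (by positivity), zero_mul] at h2
  have h4 : c ^ 2 ≤ 0 := by nlinarith [mul_nonneg (sq_nonneg c) hd0]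
  have h5 : c = 0 := by simpa using le_antisymm h4 (sq_nonneg c)
  linarith

/-- Successive minimizers are eigenvectors. -/
theorem apply_eq_mul_inner (hB : ∀ x y, B x y = B y x) {u : ℕ → W} {n : ℕ}
    (hu : ∀ i < n, IsMinimizer j B u i (u i)) {i : ℕ} (hi : i < n) (w : W) :
    B (u i) w = B (u i) (u i) * ⟪j (u i), j w⟫_ℝ := by
  induction i using Nat.strong_induction_on generalizing w with
  | _ i ih =>
    have hu' : ∀ l < i, IsMinimizer j B u l (u l) := fun l hl => hu l (hl.trans hi)
    -- The component of `w` along the earlier minimizers contributes nothing to either side: they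
    -- are eigenvectors by induction and orthogonal to `u i`. The remainder `r` satisfies the
    -- constraints of stage `i`.
    set r := w - ∑ l ∈ Finset.range i, ⟪j (u l), j w⟫_ℝ • u l with hr
    have hw : w = r + ∑ l ∈ Finset.range i, ⟪j (u l), j w⟫_ℝ • u l := by rw [hr]; abel
    have h1 := (hu i hi).apply_eq_of_orth hB (w := r) fun l hl => inner_sub_sum_eq_zero hu' w hl
    have h2 : ∀ l ∈ Finset.range i, B (u i) (u l) = 0 := fun l hl => by
      have hl' := Finset.mem_range.1 hl
      rw [hB, ih l hl' (hl'.trans hi), (hu i hi).orth l hl', mul_zero]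
    have h3 : B (u i) w = B (u i) r := by
      conv_lhs => rw [hw]
      rw [map_add, map_sum, Finset.sum_eq_zero, add_zero]
      intro l hl
      rw [map_smul, h2 l hl, smul_zero]
    have h4 : ⟪j (u i), j w⟫_ℝ = ⟪j (u i), j r⟫_ℝ := by
      conv_lhs => rw [hw]
      rw [map_add, map_sum, inner_add_right, inner_sum, Finset.sum_eq_zero, add_zero]
      intro l hl
      rw [map_smul, inner_smul_right, real_inner_comm (j (u l)) (j (u i)),
        (hu i hi).orth l (Finset.mem_range.1 hl), mul_zero]
    rw [h3, h1, h4]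

theorem minimum_mono {u : ℕ → W} {n : ℕ} (hu : ∀ i < n, IsMinimizer j B u i (u i)) {i l : ℕ}
    (hil : i ≤ l) (hl : l < n) : B (u i) (u i) ≤ B (u l) (u l) := by
  simpa [(hu l hl).norm_eq] using
    (hu i (hil.trans_lt hl)).le (u l) fun p hp => (hu l hl).orth p (hp.trans_le hil)

/-- A lower bound for `B w w` in terms of the first `n + 1` eigenvectors. -/
theorem le_apply_self (hB : ∀ x y, B x y = B y x) {u : ℕ → W} {n : ℕ}
    (hu : ∀ i < n + 1, IsMinimizer j B u i (u i)) (w : W) :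
    B (u n) (u n) * ‖j w‖ ^ 2 - ∑ i ∈ Finset.range (n + 1),
      (B (u n) (u n) - B (u i) (u i)) * ⟪j (u i), j w⟫_ℝ ^ 2 ≤ B w w := by
  set c : ℕ → ℝ := fun i => ⟪j (u i), j w⟫_ℝ with hc
  set s := ∑ l ∈ Finset.range (n + 1), c l • u l with hs
  set r := w - s with hr
  have hr0 : ∀ l < n + 1, ⟪j (u l), j r⟫_ℝ = 0 := fun l hl => inner_sub_sum_eq_zero hu w hl
  have hw : w = r + s := by rw [hr]; abel
  have hBsx : ∀ x, B s x = ∑ l ∈ Finset.range (n + 1), c l * (B (u l) (u l) * ⟪j (u l), j x⟫_ℝ) := by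
    intro x
    rw [hs, map_sum, LinearMap.sum_apply]
    refine Finset.sum_congr rfl fun l hl => ?_
    rw [map_smul, LinearMap.smul_apply, smul_eq_mul,
      apply_eq_mul_inner hB hu (Finset.mem_range.1 hl)]
  have hsx : ∀ x, ⟪j s, j x⟫_ℝ = ∑ l ∈ Finset.range (n + 1), c l * ⟪j (u l), j x⟫_ℝ := by
    intro x
    rw [hs, map_sum, sum_inner]
    refine Finset.sum_congr rfl fun l hl => ?_
    rw [map_smul, inner_smul_left]; rfl
  have hBsr : B s r = 0 := by
    rw [hBsx]
    exact Finset.sum_eq_zero fun l hl => by rw [hr0 l (Finset.mem_range.1 hl)]; ring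
  have hsr : ⟪j s, j r⟫_ℝ = 0 := by
    rw [hsx]
    exact Finset.sum_eq_zero fun l hl => by rw [hr0 l (Finset.mem_range.1 hl)]; ring
  have hBw : B w w = B r r + ∑ l ∈ Finset.range (n + 1), c l * (B (u l) (u l) * c l) := by
    have : B s w = B s s := by rw [hw, map_add, hBsr, zero_add]
    rw [← hBsx w, this]
    conv_lhs => rw [hw]
    simp only [map_add, LinearMap.add_apply, hBsr, hB r s]
    ring
  have hnw : ‖j w‖ ^ 2 = ‖j r‖ ^ 2 + ∑ l ∈ Finset.range (n + 1), c l * c l := by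
    have : ⟪j s, j w⟫_ℝ = ⟪j s, j s⟫_ℝ := by rw [hw, map_add, inner_add_right, hsr, zero_add]
    rw [← hsx w, this, real_inner_self_eq_norm_sq]
    conv_lhs => rw [hw]
    rw [map_add, norm_add_sq_real, real_inner_comm, hsr]
    ring
  -- The remainder is orthogonal to `u n` as well, which kills the cross terms; minimality of `u n`
  -- uses only the first `n` constraints.
  have hle := (hu n (Nat.lt_succ_self n)).le r fun l hl => hr0 l (hl.trans (Nat.lt_succ_self n))
  have hsum : ∑ i ∈ Finset.range (n + 1), (B (u n) (u n) - B (u i) (u i)) * c i ^ 2 =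
      B (u n) (u n) * (∑ l ∈ Finset.range (n + 1), c l * c l) -
        ∑ l ∈ Finset.range (n + 1), c l * (B (u l) (u l) * c l) := by
    rw [Finset.mul_sum, ← Finset.sum_sub_distrib]
    exact Finset.sum_congr rfl fun l _ => by ring
  rw [hBw, hnw]
  change _ - ∑ i ∈ Finset.range (n + 1), (B (u n) (u n) - B (u i) (u i)) * c i ^ 2 ≤ _
  rw [hsum]
  linarith

/-- Ky Fan's inequality. -/
theorem sum_minimum_le (hB : ∀ x y, B x y = B y x) {u : ℕ → W} {n : ℕ}
    (hu : ∀ i < n, IsMinimizer j B u i (u i)) {w : Fin n → W}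
    (hw : Orthonormal ℝ fun i => j (w i)) :
    ∑ i : Fin n, B (u i) (u i) ≤ ∑ i, B (w i) (w i) := by
  cases n with
  | zero => simp
  | succ n =>
    have h1 : ∀ l : Fin (n + 1), B (u n) (u n) - ∑ i ∈ Finset.range (n + 1),
        (B (u n) (u n) - B (u i) (u i)) * ⟪j (u i), j (w l)⟫_ℝ ^ 2 ≤ B (w l) (w l) := fun l => by
      simpa [hw.1 l] using le_apply_self hB hu (w l)
    -- Bessel's inequality for the family `w`, tested on each unit vector `u i`; the weights are
    -- nonnegative because the minima are nondecreasing.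
    have h2 : ∀ i ∈ Finset.range (n + 1),
        (B (u n) (u n) - B (u i) (u i)) * ∑ l, ⟪j (u i), j (w l)⟫_ℝ ^ 2 ≤
          B (u n) (u n) - B (u i) (u i) := by
      intro i hi
      have hi' := Finset.mem_range.1 hi
      have h3 : ∑ l, ⟪j (u i), j (w l)⟫_ℝ ^ 2 ≤ 1 := by
        have := hw.sum_inner_products_le (j (u i)) (s := Finset.univ)
        rw [(hu i hi').norm_eq, one_pow] at this
        refine le_trans (le_of_eq (Finset.sum_congr rfl fun l _ => ?_)) this
        rw [real_inner_comm, Real.norm_eq_abs, sq_abs]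
      have h4 := minimum_mono hu (Nat.lt_succ_iff.1 hi') (Nat.lt_succ_self n)
      exact mul_le_of_le_one_right (sub_nonneg.2 h4) h3
    calc ∑ i : Fin (n + 1), B (u i) (u i)
        = ∑ i ∈ Finset.range (n + 1), B (u i) (u i) :=
          Fin.sum_univ_eq_sum_range (fun i => B (u i) (u i)) (n + 1)
      _ = (n + 1) * B (u n) (u n) -
          ∑ i ∈ Finset.range (n + 1), (B (u n) (u n) - B (u i) (u i)) := by
          rw [Finset.sum_sub_distrib]; simp
      _ ≤ (n + 1) * B (u n) (u n) - ∑ i ∈ Finset.range (n + 1),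
          (B (u n) (u n) - B (u i) (u i)) * ∑ l, ⟪j (u i), j (w l)⟫_ℝ ^ 2 :=
          sub_le_sub_left (Finset.sum_le_sum h2) _
      _ = ∑ l : Fin (n + 1), (B (u n) (u n) - ∑ i ∈ Finset.range (n + 1),
          (B (u n) (u n) - B (u i) (u i)) * ⟪j (u i), j (w l)⟫_ℝ ^ 2) := by
          rw [Finset.sum_sub_distrib, Finset.sum_comm]
          simp [Finset.mul_sum]
      _ ≤ ∑ l, B (w l) (w l) := Finset.sum_le_sum fun l _ => h1 l

/-- An eigenvector whose eigenvalue is below the `n`-th minimum lies in the span of the previous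
minimizers. -/
theorem eq_sum_of_eigenvalue_lt (hj : Function.Injective j) (hB : ∀ x y, B x y = B y x)
    {u : ℕ → W} {n : ℕ} (hu : ∀ i < n + 1, IsMinimizer j B u i (u i)) {μ : ℝ} {v : W}
    (hv : ∀ w, B v w = μ * ⟪j v, j w⟫_ℝ) (hμ : μ < B (u n) (u n)) :
    v = ∑ i ∈ Finset.range n, ⟪j (u i), j v⟫_ℝ • u i := by
  have hu' : ∀ i < n, IsMinimizer j B u i (u i) := fun i hi => hu i (hi.trans (Nat.lt_succ_self n))
  set s := ∑ i ∈ Finset.range n, ⟪j (u i), j v⟫_ℝ • u i with hs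
  set r := v - s with hr
  have hr0 : ∀ l < n, ⟪j (u l), j r⟫_ℝ = 0 := fun l hl => inner_sub_sum_eq_zero hu' v hl
  have hBsr : B s r = 0 := by
    rw [hs, map_sum, LinearMap.sum_apply]
    refine Finset.sum_eq_zero fun l hl => ?_
    have hl' := Finset.mem_range.1 hl
    rw [map_smul, LinearMap.smul_apply, apply_eq_mul_inner hB hu' hl', hr0 l hl', mul_zero,
      smul_zero]
  have hsr : ⟪j s, j r⟫_ℝ = 0 := by
    rw [hs, map_sum, sum_inner]
    refine Finset.sum_eq_zero fun l hl => ?_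
    rw [map_smul, inner_smul_left, hr0 l (Finset.mem_range.1 hl), mul_zero]
  -- The remainder has Rayleigh quotient `μ` yet satisfies the constraints of stage `n`, whose
  -- minimum exceeds `μ`; so it vanishes.
  have h1 : B r r = μ * ‖j r‖ ^ 2 := by
    have h2 : B r r = B v r := by
      have h : B r = B v - B s := by rw [hr, map_sub]
      rw [h, LinearMap.sub_apply, hBsr, sub_zero]
    have h3 : ⟪j r, j r⟫_ℝ = ⟪j v, j r⟫_ℝ := by
      have h : j r = j v - j s := by rw [hr, map_sub]
      conv_lhs => arg 2; rw [h]
      rw [inner_sub_left, hsr, sub_zero]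
    rw [h2, hv, ← h3, real_inner_self_eq_norm_sq]
  have h4 := (hu n (Nat.lt_succ_self n)).le r hr0
  have h5 : ‖j r‖ ^ 2 ≤ 0 := by
    rw [h1] at h4
    by_contra! h
    nlinarith
  have h6 : j r = 0 := by
    rw [← norm_eq_zero]; simpa using le_antisymm h5 (sq_nonneg _)
  have h7 : r = 0 := hj (by rw [h6, map_zero])
  exact sub_eq_zero.1 h7

end Abstract

/-! ### Symmetric Schur-concave functions and comparison of partial sums. -/

section SchurConcave

variable {k : ℕ} {φ : (Fin k → ℝ) → ℝ} {a : ℝ}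

theorem convex_orthant : Convex ℝ (orthant k a) := by
  have : orthant k a = Set.Ici (fun _ => a) := by ext x; rfl
  rw [this]; exact convex_Ici _

/-- A convex set with nonempty interior has unique derivatives, so two derivatives of `φ` within the
orthant can be identified even at the boundary. -/
theorem uniqueDiffOn_orthant : UniqueDiffOn ℝ (orthant k a) := by
  refine uniqueDiffOn_convex convex_orthant ⟨fun _ => a + 1, ?_⟩
  have h1 : IsOpen (Set.univ.pi fun _ : Fin k => Set.Ioi a) :=
    isOpen_set_pi Set.finite_univ fun _ _ => isOpen_Ioi
  refine interior_mono (s := Set.univ.pi fun _ : Fin k => Set.Ioi a) ?_ ?_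
  · exact fun x hx i => (hx i trivial).le
  · rw [h1.interior_eq]
    intro i _
    simp

theorem partialDeriv_nonneg (hφ : DifferentiableOn ℝ φ (orthant k a))
    (hmono : MonotoneOn φ (orthant k a)) {x : Fin k → ℝ} (hx : x ∈ orthant k a) (i : Fin k) :
    0 ≤ partialDeriv φ a i x := by
  have h1 := (hφ x hx).hasFDerivWithinAt
  have hmem : ∀ t ∈ Set.Ici (0 : ℝ), x + t • Pi.single i (1 : ℝ) ∈ orthant k a := by
    intro t ht l
    have : 0 ≤ t * (Pi.single i (1 : ℝ) : Fin k → ℝ) l := mul_nonneg ht (by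
      rcases eq_or_ne l i with rfl | h
      · simp
      · simp [h])
    have := hx l
    simp only [Pi.add_apply, Pi.smul_apply, smul_eq_mul]
    linarith
  have h2 : HasDerivWithinAt (fun t : ℝ => x + t • Pi.single i (1 : ℝ))
      (Pi.single i (1 : ℝ) : Fin k → ℝ) (Set.Ici 0) 0 := by
    simpa using (((hasDerivAt_id (0 : ℝ)).smul_const
      (Pi.single i (1 : ℝ) : Fin k → ℝ)).const_add x).hasDerivWithinAt
  have h3 : HasDerivWithinAt (fun t : ℝ => φ (x + t • Pi.single i (1 : ℝ)))
      (partialDeriv φ a i x) (Set.Ici 0) 0 :=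
    HasFDerivWithinAt.comp_hasDerivWithinAt (0 : ℝ) (by simpa using h1) h2 hmem
  rw [← h3.derivWithin (uniqueDiffWithinAt_Ici 0)]
  refine MonotoneOn.derivWithin_nonneg fun s hs t ht hst => hmono (hmem s hs) (hmem t ht) ?_
  intro l
  have : 0 ≤ (Pi.single i (1 : ℝ) : Fin k → ℝ) l := by
    rcases eq_or_ne l i with rfl | h
    · simp
    · simp [h]
  simp only [Pi.add_apply, Pi.smul_apply, smul_eq_mul]
  have := mul_le_mul_of_nonneg_right hst this
  linarith

/-- The Schur condition is void when two coordinates coincide. There `x` is fixed by the swap of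
these coordinates, and differentiating the invariance of `φ` under the swap gives the equality. -/
theorem partialDeriv_eq_of_eq (hφ : DifferentiableOn ℝ φ (orthant k a))
    (hsymm : IsSymmetricOn φ a) {x : Fin k → ℝ} (hx : x ∈ orthant k a) {i l : Fin k}
    (hil : x i = x l) : partialDeriv φ a i x = partialDeriv φ a l x := by
  set P : (Fin k → ℝ) →L[ℝ] (Fin k → ℝ) :=
    ContinuousLinearMap.pi fun p => ContinuousLinearMap.proj (Equiv.swap i l p) with hP
  have hPy : ∀ y, P y = y ∘ Equiv.swap i l := fun y => rfl
  have hPx : P x = x := by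
    ext p
    rw [hPy, Function.comp_apply]
    rcases eq_or_ne p i with rfl | h1
    · rw [Equiv.swap_apply_left, hil]
    · rcases eq_or_ne p l with rfl | h2
      · rw [Equiv.swap_apply_right, hil]
      · rw [Equiv.swap_apply_of_ne_of_ne h1 h2]
  have h1 := (hφ x hx).hasFDerivWithinAt
  have h2 : HasFDerivWithinAt (φ ∘ P) ((fderivWithin ℝ φ (orthant k a) x).comp P)
      (orthant k a) x := by
    refine HasFDerivWithinAt.comp (t := orthant k a) x ?_ P.hasFDerivWithinAt ?_
    · rw [hPx]; exact h1
    · exact fun y hy p => hy _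
  have h3 : HasFDerivWithinAt φ ((fderivWithin ℝ φ (orthant k a) x).comp P) (orthant k a) x :=
    h2.congr (fun y hy => (hsymm (Equiv.swap i l) y hy).symm) (hsymm (Equiv.swap i l) x hx).symm
  have h4 := (uniqueDiffOn_orthant x hx).eq h1 h3
  have h5 : P (Pi.single i 1) = Pi.single l 1 := by
    ext p
    rw [hPy, Function.comp_apply, Pi.single_apply, Pi.single_apply]
    refine if_congr ?_ rfl rfl
    rw [Equiv.swap_apply_eq_iff, Equiv.swap_apply_left]
  unfold partialDeriv
  conv_lhs => rw [h4]
  rw [ContinuousLinearMap.comp_apply, h5]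

theorem partialDeriv_antitone (hφ : DifferentiableOn ℝ φ (orthant k a))
    (hsymm : IsSymmetricOn φ a) (hschur : IsSchurConcaveOn φ a) {x : Fin k → ℝ}
    (hx : x ∈ orthant k a) (hmono : Monotone x) : Antitone fun i => partialDeriv φ a i x := by
  intro i l hil
  rcases (hmono hil).lt_or_eq with h | h
  · have := hschur x hx i l
    change partialDeriv φ a l x ≤ partialDeriv φ a i x
    by_contra! h'
    nlinarith [mul_pos (sub_pos.2 h') (sub_pos.2 h)]
  · exact (partialDeriv_eq_of_eq hφ hsymm hx h).ge

/-- Abel summation by induction: lowering the last coefficient multiplies a nonnegative partial sum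
by something smaller. The sign of `d` plays no role until `sum_mul_nonneg`. -/
theorem last_mul_sum_le {n : ℕ} {d δ : Fin (n + 1) → ℝ} (hd : Antitone d)
    (hδ : ∀ p (hp : p ≤ n + 1), 0 ≤ ∑ i : Fin p, δ (Fin.castLE hp i)) :
    d (Fin.last n) * ∑ i, δ i ≤ ∑ i, d i * δ i := by
  induction n with
  | zero => simp
  | succ n ih =>
    have h1 := ih (d := fun i => d i.castSucc) (δ := fun i => δ i.castSucc)
      (fun i l h => hd (Fin.castSucc_le_castSucc_iff.2 h)) fun p hp => hδ p (by omega)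
    have h2 : 0 ≤ ∑ i : Fin (n + 1), δ i.castSucc := hδ (n + 1) (by omega)
    have h3 : d (Fin.last (n + 1)) ≤ d (Fin.last n).castSucc := hd (Fin.le_last _)
    rw [Fin.sum_univ_castSucc, Fin.sum_univ_castSucc (f := fun i => d i * δ i)]
    nlinarith [mul_le_mul_of_nonneg_right h3 h2]

theorem sum_mul_nonneg {d δ : Fin k → ℝ} (hd : Antitone d) (hd0 : ∀ i, 0 ≤ d i)
    (hδ : ∀ p (hp : p ≤ k), 0 ≤ ∑ i : Fin p, δ (Fin.castLE hp i)) : 0 ≤ ∑ i, d i * δ i := by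
  cases k with
  | zero => simp
  | succ n =>
    exact (mul_nonneg (hd0 _) (by simpa using hδ (n + 1) le_rfl)).trans (last_mul_sum_le hd hδ)

/-- A symmetric, increasing, Schur-concave function is monotone with respect to the comparison of
the partial sums of nondecreasing vectors. -/
theorem le_of_partial_sums_le (hφ : DifferentiableOn ℝ φ (orthant k a))
    (hsymm : IsSymmetricOn φ a) (hφmono : MonotoneOn φ (orthant k a))
    (hschur : IsSchurConcaveOn φ a) {x y : Fin k → ℝ} (hx : x ∈ orthant k a)
    (hy : y ∈ orthant k a) (hxm : Monotone x) (hym : Monotone y)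
    (hxy : ∀ p (hp : p ≤ k), ∑ i : Fin p, y (Fin.castLE hp i) ≤ ∑ i : Fin p, x (Fin.castLE hp i)) :
    φ y ≤ φ x := by
  set z : ℝ → Fin k → ℝ := fun t => y + t • (x - y) with hz
  have hzmem : ∀ t ∈ Set.Icc (0 : ℝ) 1, z t ∈ orthant k a := fun t ht =>
    convex_orthant.add_smul_sub_mem hy hx ht
  -- Both endpoints are sorted the same way, so the whole segment is, and the partial derivatives
  -- are antitone at each of its points.
  have hzmono : ∀ t ∈ Set.Icc (0 : ℝ) 1, Monotone (z t) := by
    intro t ht i l hil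
    have h1 := mul_le_mul_of_nonneg_left (hxm hil) ht.1
    have h2 := mul_le_mul_of_nonneg_left (hym hil) (sub_nonneg.2 ht.2)
    simp only [hz, Pi.add_apply, Pi.smul_apply, Pi.sub_apply, smul_eq_mul]
    linarith
  have hder : ∀ t ∈ Set.Icc (0 : ℝ) 1, HasDerivWithinAt (fun t => φ (z t))
      (fderivWithin ℝ φ (orthant k a) (z t) (x - y)) (Set.Icc 0 1) t := by
    intro t ht
    refine HasFDerivWithinAt.comp_hasDerivWithinAt t (hφ _ (hzmem t ht)).hasFDerivWithinAt ?_ hzmem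
    have h := ((hasDerivAt_id t).smul_const (x - y)).const_add y
    rw [one_smul] at h
    exact h.hasDerivWithinAt
  have hnonneg : ∀ t ∈ Set.Icc (0 : ℝ) 1, 0 ≤ fderivWithin ℝ φ (orthant k a) (z t) (x - y) := by
    intro t ht
    have h1 : x - y = ∑ i, (x i - y i) • (Pi.single i 1 : Fin k → ℝ) := by
      ext l
      simp [Finset.sum_apply, Pi.single_apply]
    rw [h1, map_sum]
    have h2 := sum_mul_nonneg (d := fun i => partialDeriv φ a i (z t)) (δ := fun i => x i - y i)
      (partialDeriv_antitone hφ hsymm hschur (hzmem t ht) (hzmono t ht))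
      (fun i => partialDeriv_nonneg hφ hφmono (hzmem t ht) i) (fun p hp => by
        rw [Finset.sum_sub_distrib]; exact sub_nonneg.2 (hxy p hp))
    refine h2.trans (le_of_eq (Finset.sum_congr rfl fun i _ => ?_))
    rw [map_smul, smul_eq_mul, mul_comm]; rfl
  have hmono : MonotoneOn (fun t => φ (z t)) (Set.Icc 0 1) := by
    refine monotoneOn_of_deriv_nonneg (convex_Icc 0 1)
      (fun t ht => (hder t ht).continuousWithinAt) ?_ ?_
    · intro t ht
      exact (hder t (interior_subset ht)).differentiableWithinAt.mono interior_subset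
    · intro t ht
      rw [((hder t (interior_subset ht)).hasDerivAt (mem_interior_iff_mem_nhds.1 ht)).deriv]
      exact hnonneg t (interior_subset ht)
  simpa [hz] using hmono (Set.left_mem_Icc.2 zero_le_one) (Set.right_mem_Icc.2 zero_le_one)
    zero_le_one

end SchurConcave

/-! ### The form `E_V` on its domain, the direct method, and the eigenvalues. -/

section Concrete

open Filter Topology
open scoped InnerProductSpace

/-- A form of Fatou's lemma. -/
theorem integrable_and_integral_le_of_tendsto {X : Type*} [MeasurableSpace X] {μ : Measure X}
    {F : ℕ → X → ℝ} {f : X → ℝ} {c : ℝ} (hF : ∀ n, Integrable (F n) μ)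
    (hF0 : ∀ n, 0 ≤ᵐ[μ] F n) (hlim : ∀ᵐ x ∂μ, Tendsto (fun n => F n x) atTop (𝓝 (f x)))
    (hc : Tendsto (fun n => ∫ x, F n x ∂μ) atTop (𝓝 c)) :
    Integrable f μ ∧ ∫ x, f x ∂μ ≤ c := by
  have hf0 : 0 ≤ᵐ[μ] f := by
    filter_upwards [hlim, ae_all_iff.2 hF0] with x hx hx0
    exact ge_of_tendsto' hx hx0
  have hfm : AEStronglyMeasurable f μ :=
    aestronglyMeasurable_of_tendsto_ae atTop (fun n => (hF n).1) hlim
  have hc0 : 0 ≤ c := ge_of_tendsto' hc fun n => integral_nonneg_of_ae (hF0 n)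
  have h1 : ∫⁻ x, ENNReal.ofReal (f x) ∂μ ≤ ENNReal.ofReal c := by
    calc ∫⁻ x, ENNReal.ofReal (f x) ∂μ
        = ∫⁻ x, liminf (fun n => ENNReal.ofReal (F n x)) atTop ∂μ := by
          refine lintegral_congr_ae ?_
          filter_upwards [hlim] with x hx
          exact ((ENNReal.continuous_ofReal.tendsto _).comp hx).liminf_eq.symm
      _ ≤ liminf (fun n => ∫⁻ x, ENNReal.ofReal (F n x) ∂μ) atTop :=
          lintegral_liminf_le' fun n => (hF n).1.aemeasurable.ennreal_ofReal
      _ = liminf (fun n => ENNReal.ofReal (∫ x, F n x ∂μ)) atTop := by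
          congr 1; ext n
          exact (ofReal_integral_eq_lintegral_ofReal (hF n) (hF0 n)).symm
      _ = ENNReal.ofReal c := ((ENNReal.continuous_ofReal.tendsto _).comp hc).liminf_eq
  have hfi : Integrable f μ := (lintegral_ofReal_ne_top_iff_integrable hfm hf0).1
    (h1.trans_lt ENNReal.ofReal_lt_top).ne
  refine ⟨hfi, ?_⟩
  rw [← ofReal_integral_eq_lintegral_ofReal hfi hf0] at h1
  exact (ENNReal.ofReal_le_ofReal_iff hc0).1 h1

variable {D : Type*} [MeasurableSpace D] {m : Measure D}
  {𝕍 : Type*} [NormedAddCommGroup 𝕍] [InnerProductSpace ℝ 𝕍]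
  {ι : 𝕍 →L[ℝ] Lp ℝ 2 m} {E : 𝕍 →L[ℝ] 𝕍 →L[ℝ] ℝ} {V : Lp ℝ 2 m} {b : ℝ}

theorem integral_mul_eq_inner (f g : Lp ℝ 2 m) : ∫ x, f x * g x ∂m = ⟪f, g⟫_ℝ := by
  rw [L2.inner_def]
  exact integral_congr_ae (.of_forall fun x => mul_comm _ _)

theorem integrable_sq (f : Lp ℝ 2 m) : Integrable (fun x => f x ^ 2) m :=
  (Lp.memLp f).integrable_sq

theorem integral_sq (f : Lp ℝ 2 m) : ∫ x, f x ^ 2 ∂m = ‖f‖ ^ 2 := by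
  rw [← real_inner_self_eq_norm_sq, ← integral_mul_eq_inner]
  exact integral_congr_ae (.of_forall fun x => sq _)

/-- The negative part of `V` is at most `|b|`, so it costs only an integrable function. -/
theorem mem_formDomain_iff (hV : ∀ᵐ x ∂m, b ≤ V x) (u : 𝕍) :
    u ∈ formDomain ι V ↔ Integrable (fun x => V x * ι u x ^ 2) m := by
  have h1 : Integrable (fun x => max (-V x) 0 * ι u x ^ 2) m := by
    refine (integrable_sq (ι u)).bdd_mul (c := |b|)
      ((Lp.aestronglyMeasurable V).neg.sup aestronglyMeasurable_const) ?_
    filter_upwards [hV] with x hx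
    rw [Real.norm_eq_abs, abs_of_nonneg (le_max_right _ _)]
    exact max_le (by linarith [neg_abs_le b]) (abs_nonneg b)
  have h2 : ∀ x, max (V x) 0 - max (-V x) 0 = V x := fun x => by
    rcases le_total 0 (V x) with h | h
    · rw [max_eq_left h, max_eq_right (by linarith)]; ring
    · rw [max_eq_right h, max_eq_left (by linarith)]; ring
  constructor
  · intro h
    refine (Integrable.sub h h1).congr (.of_forall fun x => ?_)
    simp only [Pi.sub_apply, ← sub_mul, h2]
  · intro h
    refine (h.add h1).congr (.of_forall fun x => ?_)
    simp only [Pi.add_apply, ← add_mul, ← sub_eq_iff_eq_add.1 (h2 x)]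

/-- Shifting by `b` makes the weight nonnegative, and `(V - b)|uv|` is dominated by `(V - b)(u² +
v²)`; the remaining `b u v` is integrable by Hölder. -/
theorem integrable_mul_mul (hV : ∀ᵐ x ∂m, b ≤ V x) {u v : 𝕍} (hu : u ∈ formDomain ι V)
    (hv : v ∈ formDomain ι V) : Integrable (fun x => V x * ι u x * ι v x) m := by
  rw [mem_formDomain_iff hV] at hu hv
  have hu' : Integrable (fun x => (V x - b) * ι u x ^ 2) m := by
    simp only [sub_mul]
    exact hu.sub ((integrable_sq (ι u)).const_mul b)
  have hv' : Integrable (fun x => (V x - b) * ι v x ^ 2) m := by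
    simp only [sub_mul]
    exact hv.sub ((integrable_sq (ι v)).const_mul b)
  have h1 : Integrable (fun x => (V x - b) * ι u x * ι v x) m := by
    refine (hu'.add hv').mono (((Lp.aestronglyMeasurable V).sub aestronglyMeasurable_const).mul
      (Lp.aestronglyMeasurable _) |>.mul (Lp.aestronglyMeasurable _)) ?_
    filter_upwards [hV] with x hx
    have hx' := sub_nonneg.2 hx
    simp only [Pi.add_apply, Real.norm_eq_abs]
    rw [← mul_add, mul_assoc, abs_mul, abs_mul, abs_mul (_ - _), abs_of_nonneg hx']
    refine mul_le_mul_of_nonneg_left ?_ hx'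
    rw [← abs_mul, abs_mul, abs_of_nonneg (by positivity : 0 ≤ ι u x ^ 2 + ι v x ^ 2), ← sq_abs (ι u x),
      ← sq_abs (ι v x)]
    nlinarith [sq_nonneg (|ι u x| - |ι v x|), sq_nonneg (|ι u x| + |ι v x|)]
  have h2 : Integrable (fun x => b * (ι u x * ι v x)) m :=
    ((Lp.memLp (ι u)).integrable_mul (Lp.memLp (ι v))).const_mul b
  refine (h1.add h2).congr (.of_forall fun x => ?_)
  simp only [Pi.add_apply]
  ring

theorem integrable_mul_sq_of_memLp (V : Lp ℝ 2 m) {f : D → ℝ} (hf : MemLp f 4 m) :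
    Integrable (fun x => V x * f x ^ 2) m := by
  have h1 : MemLp (fun x => f x * f x) 2 m :=
    haveI : ENNReal.HolderTriple 4 4 2 := ⟨by
      rw [← ENNReal.toReal_eq_toReal_iff' (by simp) (by simp), ENNReal.toReal_add (by simp) (by simp)]
      norm_num⟩
    hf.mul hf
  simp only [sq]
  exact (Lp.memLp V).integrable_mul h1

theorem mem_formDomain_of_memLp {u : 𝕍} (hV : ∀ᵐ x ∂m, b ≤ V x) (hu : MemLp (ι u) 4 m) :
    u ∈ formDomain ι V := (mem_formDomain_iff hV u).2 (integrable_mul_sq_of_memLp V hu)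

theorem form_self (u : 𝕍) : form ι E V u u = E u u + ∫ x, V x * ι u x ^ 2 ∂m := by
  unfold form
  congr 1
  exact integral_congr_ae (.of_forall fun x => by ring)

theorem mul_norm_sq_le_integral (hV : ∀ᵐ x ∂m, b ≤ V x) {u : 𝕍} (hu : u ∈ formDomain ι V) :
    b * ‖ι u‖ ^ 2 ≤ ∫ x, V x * ι u x ^ 2 ∂m := by
  rw [← integral_sq, ← integral_const_mul]
  refine integral_mono_ae ((integrable_sq _).const_mul b) ((mem_formDomain_iff hV u).1 hu) ?_
  filter_upwards [hV] with x hx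
  exact mul_le_mul_of_nonneg_right hx (sq_nonneg _)

theorem mul_norm_sq_le_form {α : ℝ} (hE : ∀ u, α * ‖ι u‖ ^ 2 ≤ E u u) (hV : ∀ᵐ x ∂m, b ≤ V x)
    {u : 𝕍} (hu : u ∈ formDomain ι V) : (α + b) * ‖ι u‖ ^ 2 ≤ form ι E V u u := by
  rw [form_self, add_mul]
  exact add_le_add (hE u) (mul_norm_sq_le_integral hV hu)

variable (ι) in
/-- The domain of `E_V` as a subspace. -/
def domainSubmodule (hV : ∀ᵐ x ∂m, b ≤ V x) : Submodule ℝ 𝕍 where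
  carrier := formDomain ι V
  zero_mem' := by
    rw [mem_formDomain_iff hV, map_zero]
    refine (integrable_zero D ℝ m).congr ?_
    filter_upwards [Lp.coeFn_zero ℝ 2 m] with x hx
    rw [hx]; simp
  add_mem' {u v} hu hv := by
    have h := integrable_mul_mul hV hu hv
    rw [mem_formDomain_iff hV] at hu hv ⊢
    refine ((hu.add hv).add (h.const_mul 2)).congr ?_
    filter_upwards [Lp.coeFn_add (ι u) (ι v)] with x hx
    rw [map_add, hx]
    simp only [Pi.add_apply]
    ring
  smul_mem' c u hu := by
    rw [mem_formDomain_iff hV] at hu ⊢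
    refine (hu.const_mul (c ^ 2)).congr ?_
    filter_upwards [Lp.coeFn_smul c (ι u)] with x hx
    rw [map_smul, hx]
    simp only [Pi.smul_apply, smul_eq_mul]
    ring

theorem form_comm (hE : ∀ u v, E u v = E v u) (u v : 𝕍) : form ι E V u v = form ι E V v u := by
  unfold form
  rw [hE u v]
  congr 1
  exact integral_congr_ae (.of_forall fun x => by ring)

theorem form_add_left (hV : ∀ᵐ x ∂m, b ≤ V x) {u u' v : 𝕍} (hu : u ∈ formDomain ι V)
    (hu' : u' ∈ formDomain ι V) (hv : v ∈ formDomain ι V) :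
    form ι E V (u + u') v = form ι E V u v + form ι E V u' v := by
  have h : ∫ x, V x * ι (u + u') x * ι v x ∂m =
      ∫ x, V x * ι u x * ι v x ∂m + ∫ x, V x * ι u' x * ι v x ∂m := by
    rw [← integral_add (integrable_mul_mul hV hu hv) (integrable_mul_mul hV hu' hv)]
    refine integral_congr_ae ?_
    filter_upwards [Lp.coeFn_add (ι u) (ι u')] with x hx
    rw [map_add, hx]
    simp only [Pi.add_apply]
    ring
  unfold form
  rw [h, map_add, _root_.add_apply]
  ring

theorem form_smul_left (c : ℝ) (u v : 𝕍) : form ι E V (c • u) v = c * form ι E V u v := by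
  have h : ∫ x, V x * ι (c • u) x * ι v x ∂m = c * ∫ x, V x * ι u x * ι v x ∂m := by
    rw [← integral_const_mul]
    refine integral_congr_ae ?_
    filter_upwards [Lp.coeFn_smul c (ι u)] with x hx
    rw [map_smul, hx]
    simp only [Pi.smul_apply, smul_eq_mul]
    ring
  unfold form
  rw [h, map_smul, _root_.smul_apply, smul_eq_mul]
  ring

/-- The form `E_V` as a bilinear form on its domain. -/
noncomputable def formBilin (hE : ∀ u v, E u v = E v u) (hV : ∀ᵐ x ∂m, b ≤ V x) :
    domainSubmodule ι hV →ₗ[ℝ] domainSubmodule ι hV →ₗ[ℝ] ℝ :=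
  LinearMap.mk₂ ℝ (fun u v => form ι E V u v)
    (fun u u' v => form_add_left (ι := ι) hV u.2 u'.2 v.2)
    (fun c u v => form_smul_left c (u : 𝕍) (v : 𝕍))
    (fun u v v' => by
      rw [form_comm hE, form_comm hE u v, form_comm hE u v']
      exact form_add_left (ι := ι) hV v.2 v'.2 u.2)
    (fun c u v => by
      rw [form_comm hE, form_comm hE u v]
      exact form_smul_left c (v : 𝕍) (u : 𝕍))

variable (ι) in
/-- The embedding of the domain of `E_V` in `L²`. -/
def domainEmbedding (hV : ∀ᵐ x ∂m, b ≤ V x) : domainSubmodule ι hV →ₗ[ℝ] Lp ℝ 2 m :=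
  (ι : 𝕍 →ₗ[ℝ] Lp ℝ 2 m) ∘ₗ (domainSubmodule ι hV).subtype

theorem formBilin_symm (hE : ∀ u v, E u v = E v u) (hV : ∀ᵐ x ∂m, b ≤ V x)
    (x y : domainSubmodule ι hV) : formBilin hE hV x y = formBilin hE hV y x :=
  form_comm hE (x : 𝕍) (y : 𝕍)

/-- Dimension count: `n` linear constraints on the span of `k > n` independent vectors leave a
nonzero solution. -/
theorem exists_orthogonal_ne_zero {W H : Type*} [AddCommGroup W] [Module ℝ W]
    [NormedAddCommGroup H] [InnerProductSpace ℝ H] (j : W →ₗ[ℝ] H) (u : ℕ → W) {n k : ℕ}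
    (hnk : n < k) {e : Fin k → W} (he : LinearIndependent ℝ e) :
    ∃ v : W, v ≠ 0 ∧ ∀ l < n, ⟪j (u l), j v⟫_ℝ = 0 := by
  set T : (Fin k → ℝ) →ₗ[ℝ] (Fin n → ℝ) :=
    (LinearMap.pi fun l : Fin n => (innerₗ H (j (u l))) ∘ₗ j) ∘ₗ Fintype.linearCombination ℝ e
    with hT
  obtain ⟨c, hc, hc0⟩ := (Submodule.ne_bot_iff _).1
    (LinearMap.ker_ne_bot_of_finrank_lt (f := T) (by simpa using hnk))
  refine ⟨Fintype.linearCombination ℝ e c, fun h => hc0 ?_, fun l hl => ?_⟩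
  · ext i
    exact Fintype.linearIndependent_iff.1 he c (by rwa [Fintype.linearCombination_apply] at h) i
  · exact congrFun (LinearMap.mem_ker.1 hc) ⟨l, hl⟩

/-- The direct method: the Rayleigh quotient of `E_V` attains its minimum under finitely many
orthogonality constraints. -/
theorem exists_isMinimizer [CompleteSpace 𝕍] (hι : Function.Injective ι) (hιc : IsCompactOperator ι)
    (hE : ∀ u v, E u v = E v u) {α M : ℝ} (hM : 0 < M) (hEα : ∀ u, α * ‖ι u‖ ^ 2 ≤ E u u)
    (hEM : ∀ u, M⁻¹ * ‖u‖ ^ 2 ≤ E u u + ‖ι u‖ ^ 2) (hV : ∀ᵐ x ∂m, b ≤ V x)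
    (u : ℕ → domainSubmodule ι hV) (n : ℕ)
    (hne : ∃ v, v ≠ 0 ∧ ∀ l < n, ⟪domainEmbedding ι hV (u l), domainEmbedding ι hV v⟫_ℝ = 0) :
    ∃ v, IsMinimizer (domainEmbedding ι hV) (formBilin hE hV) u n v := by
  set j := domainEmbedding ι hV with hj
  set B := formBilin hE hV with hBdef
  have hjinj : Function.Injective j := hι.comp Subtype.val_injective
  have hBsymm : ∀ x y, B x y = B y x := formBilin_symm hE hV
  have hBself : ∀ x : domainSubmodule ι hV,
      B x x = E x x + ∫ y, V y * ι x y ^ 2 ∂m := fun x => form_self (x : 𝕍)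
  have hBα : ∀ x, (α + b) * ‖j x‖ ^ 2 ≤ B x x := fun x => mul_norm_sq_le_form hEα hV x.2
  have hEB : ∀ x : domainSubmodule ι hV, E x x ≤ B x x - b * ‖j x‖ ^ 2 := fun x => by
    have := mul_norm_sq_le_integral hV x.2
    rw [hBself]
    change b * ‖j x‖ ^ 2 ≤ _ at this
    linarith
  have hMB : ∀ x : domainSubmodule ι hV, ‖x‖ ^ 2 ≤ M * (B x x + (1 - b) * ‖j x‖ ^ 2) := fun x => by
    have h1 : M⁻¹ * ‖x‖ ^ 2 ≤ E x x + ‖j x‖ ^ 2 := hEM x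
    have h2 := hEB x
    rw [inv_mul_le_iff₀ hM] at h1
    refine h1.trans (mul_le_mul_of_nonneg_left ?_ hM.le)
    linarith
  set C : Set (domainSubmodule ι hV) := {x | ∀ l < n, ⟪j (u l), j x⟫_ℝ = 0} with hC
  have hCsmul : ∀ (c : ℝ) {x}, x ∈ C → c • x ∈ C := fun c x hx l hl => by
    rw [map_smul, inner_smul_right, hx l hl, mul_zero]
  have hCadd : ∀ {x y}, x ∈ C → y ∈ C → x + y ∈ C := fun {x y} hx hy l hl => by
    rw [map_add, inner_add_right, hx l hl, hy l hl, add_zero]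
  have hnormalize : ∀ x ∈ C, x ≠ 0 → ∃ y ∈ C, ‖j y‖ = 1 ∧ B y y * ‖j x‖ ^ 2 = B x x := by
    intro x hx hx0
    have hjx : ‖j x‖ ≠ 0 := by
      rw [norm_ne_zero_iff]
      exact fun h => hx0 (hjinj (by rw [h, map_zero]))
    refine ⟨‖j x‖⁻¹ • x, hCsmul _ hx, ?_, ?_⟩
    · rw [map_smul, norm_smul, norm_inv, norm_norm, inv_mul_cancel₀ hjx]
    · simp only [map_smul, LinearMap.smul_apply, smul_eq_mul]
      field_simp
  set S : Set ℝ := {t | ∃ x ∈ C, ‖j x‖ = 1 ∧ B x x = t} with hS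
  have hSne : S.Nonempty := by
    obtain ⟨x, hx0, hx⟩ := hne
    obtain ⟨y, hy, hy1, -⟩ := hnormalize x hx hx0
    exact ⟨_, y, hy, hy1, rfl⟩
  have hSbdd : BddBelow S := by
    refine ⟨α + b, ?_⟩
    rintro t ⟨x, -, hx1, rfl⟩
    simpa [hx1] using hBα x
  set lam := sInf S with hlam
  have hlamle : ∀ x ∈ C, lam * ‖j x‖ ^ 2 ≤ B x x := by
    intro x hx
    rcases eq_or_ne x 0 with rfl | hx0
    · simp
    · obtain ⟨y, hy, hy1, hyx⟩ := hnormalize x hx hx0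
      rw [← hyx]
      exact mul_le_mul_of_nonneg_right (csInf_le hSbdd ⟨y, hy, hy1, rfl⟩) (sq_nonneg _)
  have hseq : ∀ p : ℕ, ∃ x ∈ C, ‖j x‖ = 1 ∧ B x x < lam + 1 / ((p : ℝ) + 1) := by
    intro p
    obtain ⟨t, ⟨x, hx, hx1, rfl⟩, ht⟩ := Real.lt_sInf_add_pos hSne
      (show (0 : ℝ) < 1 / ((p : ℝ) + 1) by positivity)
    exact ⟨x, hx, hx1, ht⟩
  choose v₀ hv₀C hv₀1 hv₀lt using hseq
  -- The radius is the bound `hMB` for a vector with `‖j x‖ = 1` and `B x x ≤ lam + 1`.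
  obtain ⟨h, -, ψ, hψ, hψlim⟩ := (hιc.isCompact_closure_image_closedBall
    (√(M * (lam + 1 + (1 - b))))).tendsto_subseq (x := fun p => ι (v₀ p)) fun p => by
      refine subset_closure ⟨v₀ p, ?_, rfl⟩
      rw [mem_closedBall_zero_iff]
      refine Real.le_sqrt_of_sq_le ((hMB (v₀ p)).trans (mul_le_mul_of_nonneg_left ?_ hM.le))
      have h1 : 1 / ((p : ℝ) + 1) ≤ 1 := by
        rw [div_le_one (by positivity)]
        linarith [(Nat.cast_nonneg p : (0 : ℝ) ≤ p)]
      rw [hv₀1]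
      linarith [hv₀lt p]
  set v₁ : ℕ → domainSubmodule ι hV := v₀ ∘ ψ with hv₁
  have hv₁lim : Tendsto (fun p => j (v₁ p)) atTop (𝓝 h) := hψlim
  have hBv₁ : Tendsto (fun p => B (v₁ p) (v₁ p)) atTop (𝓝 lam) := by
    have h1 : Tendsto (fun p : ℕ => lam + 1 / ((p : ℝ) + 1)) atTop (𝓝 lam) := by
      simpa using tendsto_one_div_add_atTop_nhds_zero_nat.const_add lam
    refine tendsto_of_tendsto_of_tendsto_of_le_of_le tendsto_const_nhds
      (h1.comp hψ.tendsto_atTop) (fun p => ?_) fun p => (hv₀lt (ψ p)).le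
    simpa [hv₁, hv₀1] using hlamle (v₁ p) (hv₀C _)
  -- Convergence in `L²` is upgraded to `𝕍`: by the parallelogram law, `B` of a difference equals `2
  -- B x x + 2 B y y` minus `B` of the sum. The latter is at least `lam` times `‖j (x + y)‖² = 4 -
  -- ‖j x - j y‖²`.
  have hcauchy : CauchySeq fun p => (v₁ p : 𝕍) := by
    rw [cauchySeq_iff_tendsto_dist_atTop_0]
    have hjd : Tendsto (fun p : ℕ × ℕ => ‖j (v₁ p.1) - j (v₁ p.2)‖) atTop (𝓝 0) := by
      simpa only [dist_eq_norm] using cauchySeq_iff_tendsto_dist_atTop_0.1 hv₁lim.cauchySeq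
    have hB1 : Tendsto (fun p : ℕ × ℕ => B (v₁ p.1) (v₁ p.1)) atTop (𝓝 lam) := by
      rw [← prod_atTop_atTop_eq]; exact hBv₁.comp tendsto_fst
    have hB2 : Tendsto (fun p : ℕ × ℕ => B (v₁ p.2) (v₁ p.2)) atTop (𝓝 lam) := by
      rw [← prod_atTop_atTop_eq]; exact hBv₁.comp tendsto_snd
    have hrhs : Tendsto (fun p : ℕ × ℕ => √(M * (2 * B (v₁ p.1) (v₁ p.1) +
        2 * B (v₁ p.2) (v₁ p.2) - 4 * lam +
        (lam + (1 - b)) * ‖j (v₁ p.1) - j (v₁ p.2)‖ ^ 2))) atTop (𝓝 0) := by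
      have := (((((hB1.const_mul 2).add (hB2.const_mul 2)).sub_const (4 * lam)).add
        ((hjd.pow 2).const_mul (lam + (1 - b)))).const_mul M).sqrt
      convert this using 2
      rw [eq_comm, Real.sqrt_eq_zero']
      exact le_of_eq (by ring)
    refine squeeze_zero (fun p => dist_nonneg) (fun p => ?_) hrhs
    rw [dist_eq_norm]
    refine Real.le_sqrt_of_sq_le ((hMB (v₁ p.1 - v₁ p.2)).trans
      (mul_le_mul_of_nonneg_left ?_ hM.le))
    have h1 := hlamle _ (hCadd (hv₀C (ψ p.1)) (hv₀C (ψ p.2)))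
    change lam * ‖j (v₁ p.1 + v₁ p.2)‖ ^ 2 ≤ B (v₁ p.1 + v₁ p.2) (v₁ p.1 + v₁ p.2) at h1
    have h2 := parallelogram_law_with_norm ℝ (j (v₁ p.1)) (j (v₁ p.2))
    have h3 : ‖j (v₁ p.1)‖ = 1 := hv₀1 _
    have h4 : ‖j (v₁ p.2)‖ = 1 := hv₀1 _
    rw [h3, h4] at h2
    have h5 : ‖j (v₁ p.1) + j (v₁ p.2)‖ ^ 2 = 4 - ‖j (v₁ p.1) - j (v₁ p.2)‖ ^ 2 := by linarith
    rw [map_add, h5] at h1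
    simp only [map_add, map_sub, LinearMap.add_apply, LinearMap.sub_apply] at h1 ⊢
    linarith
  obtain ⟨v, hv⟩ := cauchySeq_tendsto_of_complete hcauchy
  have hιv : Tendsto (fun p => ι (v₁ p)) atTop (𝓝 (ι v)) := (ι.continuous.tendsto v).comp hv
  have hEv : Tendsto (fun p => E (v₁ p) (v₁ p)) atTop (𝓝 (E v v)) := by
    have : Continuous fun x => E x x := by fun_prop
    exact (this.tendsto v).comp hv
  obtain ⟨θ, hθ, hθlim⟩ :=
    (tendstoInMeasure_of_tendsto_Lp hιv).exists_seq_tendsto_ae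
  have hint : ∀ x : domainSubmodule ι hV, Integrable (fun y => V y * ι x y ^ 2) m :=
    fun x => (mem_formDomain_iff hV _).1 x.2
  have hint' : ∀ x : domainSubmodule ι hV, Integrable (fun y => (V y - b) * ι x y ^ 2) m :=
    fun x => by
      simp only [sub_mul]
      exact (hint x).sub ((integrable_sq (ι x)).const_mul b)
  have hnormv : ‖ι v‖ = 1 := by
    refine tendsto_nhds_unique hιv.norm ?_
    have : ∀ p, ‖ι (v₁ p)‖ = 1 := fun p => hv₀1 _
    simp only [this, tendsto_const_nhds]
  -- The potential term need not be continuous on `𝕍`, so Fatou is applied along an a.e. convergent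
  -- subsequence, with `V - b` to have nonnegative integrands. It yields both `v ∈ D(E_V)` and `B v
  -- v ≤ lam`.
  obtain ⟨hvint, hvle⟩ := integrable_and_integral_le_of_tendsto
    (F := fun p y => (V y - b) * ι (v₁ (θ p)) y ^ 2) (f := fun y => (V y - b) * ι v y ^ 2)
    (c := lam - E v v - b) (fun p => hint' _) (fun p => by
      filter_upwards [hV] with y hy
      exact mul_nonneg (sub_nonneg.2 hy) (sq_nonneg _))
    (by
      filter_upwards [hθlim] with y hy
      exact (hy.pow 2).const_mul _)
    (by
      have h1 : ∀ p, ∫ y, (V y - b) * ι (v₁ p) y ^ 2 ∂m =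
          B (v₁ p) (v₁ p) - E (v₁ p) (v₁ p) - b := fun p => by
        have h2 : ‖ι (v₁ p)‖ = 1 := hv₀1 _
        simp only [sub_mul]
        rw [integral_sub (hint _) ((integrable_sq _).const_mul b), integral_const_mul, integral_sq,
          h2, hBself]
        ring
      simp only [h1]
      exact ((hBv₁.sub hEv).sub_const b).comp hθ.tendsto_atTop)
  have hvint' : Integrable (fun y => V y * ι v y ^ 2) m := by
    refine (hvint.add ((integrable_sq (ι v)).const_mul b)).congr (.of_forall fun y => ?_)
    simp only [Pi.add_apply]
    ring
  have hvD : v ∈ domainSubmodule ι hV := (mem_formDomain_iff hV v).2 hvint'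
  refine ⟨⟨v, hvD⟩, hnormv, fun l hl => ?_, fun w hw => ?_⟩
  · refine tendsto_nhds_unique
      (((continuous_const.inner continuous_id).tendsto (ι v)).comp hιv) ?_
    have : ∀ p, ⟪j (u l), ι (v₁ p)⟫_ℝ = 0 := fun p => hv₀C (ψ p) l hl
    simp only [Function.comp_def, id, this]
    exact tendsto_const_nhds
  · refine le_trans (mul_le_mul_of_nonneg_right ?_ (sq_nonneg _)) (hlamle w hw)
    rw [hBself]
    simp only [sub_mul] at hvle
    rw [integral_sub hvint' ((integrable_sq _).const_mul b), integral_const_mul, integral_sq,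
      hnormv] at hvle
    linarith

theorem isEigenfunction_iff (hE : ∀ u v, E u v = E v u) (hV : ∀ᵐ x ∂m, b ≤ V x) {μ : ℝ} {v : 𝕍} :
    IsEigenfunction ι E V μ v ↔ ∃ v' : domainSubmodule ι hV, v' = v ∧ v' ≠ 0 ∧ ∀ w,
      formBilin hE hV v' w = μ * ⟪domainEmbedding ι hV v', domainEmbedding ι hV w⟫_ℝ := by
  constructor
  · rintro ⟨h1, h2, h3⟩
    refine ⟨⟨v, h1⟩, rfl, fun h => h2 (congrArg Subtype.val h), fun w => ?_⟩
    rw [← integral_mul_eq_inner]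
    exact h3 w w.2
  · rintro ⟨v', rfl, h2, h3⟩
    refine ⟨v'.2, fun h => h2 (Subtype.ext h), fun w hw => ?_⟩
    rw [integral_mul_eq_inner]
    exact h3 ⟨w, hw⟩

theorem isEigenfunction_minimizer (hE : ∀ u v, E u v = E v u) (hV : ∀ᵐ x ∂m, b ≤ V x)
    {u : ℕ → domainSubmodule ι hV} {n : ℕ}
    (hu : ∀ i < n, IsMinimizer (domainEmbedding ι hV) (formBilin hE hV) u i (u i)) {i : ℕ}
    (hi : i < n) : IsEigenfunction ι E V (formBilin hE hV (u i) (u i)) (u i) := by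
  refine (isEigenfunction_iff hE hV).2 ⟨u i, rfl, fun h => ?_,
    apply_eq_mul_inner (formBilin_symm hE hV) hu hi⟩
  have := (hu i hi).norm_eq
  rw [h, map_zero, norm_zero] at this
  exact zero_ne_one this

theorem orthonormal_minimizer (hE : ∀ u v, E u v = E v u) (hV : ∀ᵐ x ∂m, b ≤ V x)
    {u : ℕ → domainSubmodule ι hV} {n : ℕ}
    (hu : ∀ i < n, IsMinimizer (domainEmbedding ι hV) (formBilin hE hV) u i (u i)) :
    Orthonormal ℝ fun i : Fin n => ι (u i) := by
  refine ⟨fun i => (hu i i.2).norm_eq, fun i l hil => ?_⟩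
  have := inner_eq_ite hu i.2 l.2
  rwa [if_neg (fun h => hil (Fin.ext h))] at this

/-- The eigenvalues are the successive constrained minima of the Rayleigh quotient. -/
theorem eigenvalue_eq (hι : Function.Injective ι) (hE : ∀ u v, E u v = E v u)
    (hV : ∀ᵐ x ∂m, b ≤ V x) {u : ℕ → domainSubmodule ι hV} {n : ℕ}
    (hu : ∀ i < n + 1, IsMinimizer (domainEmbedding ι hV) (formBilin hE hV) u i (u i)) :
    eigenvalue ι E V n = formBilin hE hV (u n) (u n) := by
  have hjinj : Function.Injective (domainEmbedding ι hV) := hι.comp Subtype.val_injective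
  -- At the level of the minimum `n` there are `n + 1` independent eigenfunctions; below it, all
  -- eigenfunctions lie in the span of only `n` minimizers.
  refine IsLeast.csInf_eq ⟨?_, fun t ht => ?_⟩
  · have hli : LinearIndependent ℝ fun i : Fin (n + 1) => (u i : 𝕍) :=
      LinearIndependent.of_comp (ι : 𝕍 →ₗ[ℝ] Lp ℝ 2 m)
        (orthonormal_minimizer hE hV hu).linearIndependent
    have h1 : Submodule.span ℝ (Set.range fun i : Fin (n + 1) => (u i : 𝕍)) ≤
        eigenspaceLE ι E V (formBilin hE hV (u n) (u n)) := by
      refine Submodule.span_mono ?_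
      rintro _ ⟨i, rfl⟩
      exact ⟨_, minimum_mono hu (Nat.lt_succ_iff.1 i.2) (Nat.lt_succ_self n),
        isEigenfunction_minimizer hE hV hu i.2⟩
    have h2 := Submodule.rank_mono h1
    have := FiniteDimensional.span_of_finite ℝ
      (Set.finite_range fun i : Fin (n + 1) => (u i : 𝕍))
    rwa [← Module.finrank_eq_rank, finrank_span_eq_card hli, Fintype.card_fin] at h2
  · by_contra! hlt
    have h1 : eigenspaceLE ι E V t ≤ Submodule.span ℝ (Set.range fun i : Fin n => (u i : 𝕍)) := by
      refine Submodule.span_le.2 ?_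
      rintro v ⟨μ, hμ, hv⟩
      obtain ⟨v', rfl, -, hv'⟩ := (isEigenfunction_iff hE hV).1 hv
      have h2 := eq_sum_of_eigenvalue_lt hjinj (formBilin_symm hE hV) hu hv' (hμ.trans_lt hlt)
      rw [SetLike.mem_coe, h2, Submodule.coe_sum]
      refine Submodule.sum_mem _ fun i hi => ?_
      exact Submodule.smul_mem _ _ (Submodule.subset_span ⟨⟨i, Finset.mem_range.1 hi⟩, rfl⟩)
    have := FiniteDimensional.span_of_finite ℝ
      (Set.finite_range fun i : Fin n => (u i : 𝕍))
    have h2 := le_trans (show ((n + 1 : ℕ) : Cardinal) ≤ _ from ht) (Submodule.rank_mono h1)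
    rw [← Module.finrank_eq_rank, Nat.cast_le] at h2
    have h3 := h2.trans (finrank_range_le_card (R := ℝ) fun i : Fin n => (u i : 𝕍))
    rw [Fintype.card_fin] at h3
    omega

end Concrete

/-! ### The variational characterization and concavity. -/

variable {D : Type*} [MeasurableSpace D] {m : Measure D}
  {𝕍 : Type*} [NormedAddCommGroup 𝕍] [InnerProductSpace ℝ 𝕍] {ι : 𝕍 →L[ℝ] Lp ℝ 2 m}
  {E : 𝕍 →L[ℝ] 𝕍 →L[ℝ] ℝ}

theorem form_self_mem_orthant {V : Lp ℝ 2 m} {α b : ℝ} (hE : ∀ u, α * ‖ι u‖ ^ 2 ≤ E u u)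
    (hV : ∀ᵐ x ∂m, b ≤ V x) {k : ℕ} {w : Fin k → 𝕍} (hw4 : ∀ i, MemLp (ι (w i)) 4 m)
    (hw : Orthonormal ℝ fun i => ι (w i)) :
    (fun i => form ι E V (w i) (w i)) ∈ orthant k (α + b) := fun i => by
  simpa [hw.1 i] using mul_norm_sq_le_form hE hV (mem_formDomain_of_memLp hV (hw4 i))

/-- For `u` in `L⁴` both potential integrals converge, so the integral splits; `s + t = 1` is what
keeps the term `E u u` unchanged. -/
theorem form_self_convexCombination (V₀ V₁ : Lp ℝ 2 m) {s t : ℝ} (hst : s + t = 1) {u : 𝕍}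
    (hu : MemLp (ι u) 4 m) :
    form ι E (s • V₀ + t • V₁) u u = s * form ι E V₀ u u + t * form ι E V₁ u u := by
  have h : ∫ x, (s • V₀ + t • V₁ : Lp ℝ 2 m) x * ι u x ^ 2 ∂m =
      s * ∫ x, V₀ x * ι u x ^ 2 ∂m + t * ∫ x, V₁ x * ι u x ^ 2 ∂m := by
    rw [← integral_const_mul, ← integral_const_mul,
      ← integral_add ((integrable_mul_sq_of_memLp V₀ hu).const_mul s) ((integrable_mul_sq_of_memLp V₁ hu).const_mul t)]
    refine integral_congr_ae ?_
    filter_upwards [Lp.coeFn_add (s • V₀) (t • V₁), Lp.coeFn_smul s V₀, Lp.coeFn_smul t V₁]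
      with x h1 h2 h3
    rw [h1, Pi.add_apply, h2, h3]
    simp only [Pi.smul_apply, smul_eq_mul]
    ring
  rw [form_self, form_self, form_self, h]
  linear_combination (-(E u u)) * hst

theorem exists_minimizing_sequence [CompleteSpace 𝕍] (hι : Function.Injective ι)
    (hιc : IsCompactOperator ι) (hE : ∀ u v, E u v = E v u) {α M : ℝ} (hM : 0 < M)
    (hEα : ∀ u, α * ‖ι u‖ ^ 2 ≤ E u u) (hEM : ∀ u, M⁻¹ * ‖u‖ ^ 2 ≤ E u u + ‖ι u‖ ^ 2)
    {V : Lp ℝ 2 m} {b : ℝ} (hV : ∀ᵐ x ∂m, b ≤ V x) {k : ℕ}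
    (hdim : ∃ u : Fin k → 𝕍, LinearIndependent ℝ u ∧ ∀ i, u i ∈ formDomain ι V) :
    ∃ u : ℕ → domainSubmodule ι hV,
      ∀ i < k, IsMinimizer (domainEmbedding ι hV) (formBilin hE hV) u i (u i) := by
  obtain ⟨e, he, heD⟩ := hdim
  refine exists_minimizers (fun u n hn => exists_isMinimizer hι hιc hE hM hEα hEM hV u n ?_) k le_rfl
  exact exists_orthogonal_ne_zero _ u hn (e := fun i => (⟨e i, heD i⟩ : domainSubmodule ι hV))
    (LinearIndependent.of_comp (domainSubmodule ι hV).subtype he)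

/-- The variational characterization of `spectralFunctional` for a single potential. -/
theorem isLeast_spectralFunctional [CompleteSpace 𝕍] (hι : Function.Injective ι)
    (hιc : IsCompactOperator ι) (hE : ∀ u v, E u v = E v u) {α M : ℝ} (hM : 0 < M)
    (hEα : ∀ u, α * ‖ι u‖ ^ 2 ≤ E u u) (hEM : ∀ u, M⁻¹ * ‖u‖ ^ 2 ≤ E u u + ‖ι u‖ ^ 2)
    {V : Lp ℝ 2 m} {b : ℝ} (hV : ∀ᵐ x ∂m, b ≤ V x)
    (hL4 : ∀ (μ : ℝ) (u : 𝕍), IsEigenfunction ι E V μ u → MemLp (ι u) 4 m) {k : ℕ}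
    (hdim : ∃ u : Fin k → 𝕍, LinearIndependent ℝ u ∧ ∀ i, u i ∈ formDomain ι V)
    {φ : (Fin k → ℝ) → ℝ} (hφ : DifferentiableOn ℝ φ (orthant k (α + b)))
    (hsymm : IsSymmetricOn φ (α + b)) (hmono : MonotoneOn φ (orthant k (α + b)))
    (hschur : IsSchurConcaveOn φ (α + b)) :
    IsLeast {y : ℝ | ∃ w : Fin k → 𝕍, (∀ i, MemLp (ι (w i)) 4 m) ∧
        Orthonormal ℝ (fun i => ι (w i)) ∧ y = φ (fun i => form ι E V (w i) (w i))}
      (spectralFunctional ι E φ V) := by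
  obtain ⟨u, hu⟩ := exists_minimizing_sequence hι hιc hE hM hEα hEM hV hdim
  have heig : (fun i : Fin k => eigenvalue ι E V i) = fun i : Fin k =>
      form ι E V (u i) (u i) := by
    ext i
    exact eigenvalue_eq hι hE hV fun l hl => hu l (by omega)
  have hu4 : ∀ i : Fin k, MemLp (ι (u i)) 4 m := fun i =>
    hL4 _ _ (isEigenfunction_minimizer hE hV hu i.2)
  have hu1 := orthonormal_minimizer hE hV hu
  unfold spectralFunctional
  rw [heig]
  refine ⟨⟨fun i => u i, hu4, hu1, rfl⟩, ?_⟩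
  rintro _ ⟨w, hw4, hw1, rfl⟩
  set x : Fin k → ℝ := fun i => form ι E V (w i) (w i) with hx
  have hxmem : x ∈ orthant k (α + b) := form_self_mem_orthant hEα hV hw4 hw1
  set σ := Tuple.sort x with hσ
  rw [← hsymm σ x hxmem]
  refine le_of_partial_sums_le hφ hsymm hmono hschur (fun i => hxmem (σ i))
    (form_self_mem_orthant hEα hV hu4 hu1) (Tuple.monotone_sort x)
    (fun i l hil => minimum_mono hu hil l.2) fun p hp => ?_
  -- Ky Fan for the `p` vectors of smallest energy, which the sorting permutation puts first; the
  -- reindexing is injective, so they stay orthonormal.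
  exact sum_minimum_le (formBilin_symm hE hV) (fun i hi => hu i (hi.trans_le hp))
    (w := fun i : Fin p => (⟨w (σ (Fin.castLE hp i)), mem_formDomain_of_memLp hV (hw4 _)⟩ :
      domainSubmodule ι hV))
    (hw1.comp (fun i : Fin p => σ (Fin.castLE hp i))
      (σ.injective.comp (Fin.castLE_injective hp)))

end SchrodingerPotential

theorem proposition5p7
    {D : Type*} [MeasurableSpace D] (m : Measure D) [IsFiniteMeasure m]
    {𝕍 : Type*} [NormedAddCommGroup 𝕍] [InnerProductSpace ℝ 𝕍] [CompleteSpace 𝕍]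
    -- the dense and compact embedding of `𝕍` in `L²(D, m)`
    (ι : 𝕍 →L[ℝ] Lp ℝ 2 m) (hι_inj : Function.Injective ι) (hι_dense : DenseRange ι)
    (hι_compact : IsCompactOperator ι)
    -- the continuous, symmetric, weakly coercive form
    (E : 𝕍 →L[ℝ] 𝕍 →L[ℝ] ℝ) (hE_symm : ∀ u v, E u v = E v u)
    (α M : ℝ) (hα : 0 ≤ α) (hM : 0 < M)
    (hE_lower : ∀ u, α * ‖ι u‖ ^ 2 ≤ E u u)
    (hE_equiv : ∀ u, M⁻¹ * ‖u‖ ^ 2 ≤ E u u + ‖ι u‖ ^ 2 ∧ E u u + ‖ι u‖ ^ 2 ≤ M * ‖u‖ ^ 2)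
    -- the convex set of admissible potentials
    (K : Set (Lp ℝ 2 m)) (hK_convex : Convex ℝ K)
    (Vmin : ℝ) (hK_lower : ∀ V ∈ K, ∀ᵐ x ∂m, Vmin ≤ V x)
    -- eigenfunctions belong to `L⁴(D, m)`
    (hL4 : ∀ V ∈ K, ∀ (μ : ℝ) (u : 𝕍),
      SchrodingerPotential.IsEigenfunction ι E V μ u → MemLp (ι u) 4 m)
    (k : ℕ)
    -- `D(E_V)` has dimension at least `k`, so that the first `k` eigenvalues exist
    (hdim : ∀ V ∈ K, ∃ u : Fin k → 𝕍, LinearIndependent ℝ u ∧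
      ∀ i, u i ∈ SchrodingerPotential.formDomain ι V)
    (φ : (Fin k → ℝ) → ℝ)
    (hφ_C1 : ContDiffOn ℝ 1 φ (SchrodingerPotential.orthant k (α + Vmin)))
    (hφ_symm : SchrodingerPotential.IsSymmetricOn φ (α + Vmin))
    (hφ_mono : MonotoneOn φ (SchrodingerPotential.orthant k (α + Vmin)))
    (hφ_schur : SchrodingerPotential.IsSchurConcaveOn φ (α + Vmin)) :
    (∀ V ∈ K, IsLeast
      {y : ℝ | ∃ w : Fin k → 𝕍, (∀ i, MemLp (ι (w i)) 4 m) ∧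
        Orthonormal ℝ (fun i => ι (w i)) ∧
        y = φ (fun i => SchrodingerPotential.form ι E V (w i) (w i))}
      (SchrodingerPotential.spectralFunctional ι E φ V)) ∧
    (ConcaveOn ℝ (SchrodingerPotential.orthant k (α + Vmin)) φ →
      ConcaveOn ℝ K (SchrodingerPotential.spectralFunctional ι E φ)) := by
  have hleast : ∀ V ∈ K, IsLeast
      {y : ℝ | ∃ w : Fin k → 𝕍, (∀ i, MemLp (ι (w i)) 4 m) ∧
        Orthonormal ℝ (fun i => ι (w i)) ∧
        y = φ (fun i => SchrodingerPotential.form ι E V (w i) (w i))}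
      (SchrodingerPotential.spectralFunctional ι E φ V) := fun V hV =>
    SchrodingerPotential.isLeast_spectralFunctional hι_inj hι_compact hE_symm hM hE_lower
      (fun u => (hE_equiv u).1) (hK_lower V hV) (hL4 V hV) (hdim V hV)
      (hφ_C1.differentiableOn one_ne_zero) hφ_symm hφ_mono hφ_schur
  refine ⟨hleast, fun hconc => ⟨hK_convex, fun V₀ hV₀ V₁ hV₁ s t hs ht hst => ?_⟩⟩
  -- An optimal family for the combined potential is tested as a competitor for `V₀` and for `V₁`.
  obtain ⟨w, hw4, hw1, hw⟩ := (hleast _ (hK_convex hV₀ hV₁ hs ht hst)).1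
  have h0 := (hleast V₀ hV₀).2 ⟨w, hw4, hw1, rfl⟩
  have h1 := (hleast V₁ hV₁).2 ⟨w, hw4, hw1, rfl⟩
  have hx := hconc.2
    (SchrodingerPotential.form_self_mem_orthant hE_lower (hK_lower V₀ hV₀) hw4 hw1)
    (SchrodingerPotential.form_self_mem_orthant hE_lower (hK_lower V₁ hV₁) hw4 hw1) hs ht hst
  rw [hw]
  refine (add_le_add (mul_le_mul_of_nonneg_left h0 hs) (mul_le_mul_of_nonneg_left h1 ht)).trans
    (hx.trans (le_of_eq (congrArg φ (funext fun i => ?_))))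
  exact (SchrodingerPotential.form_self_convexCombination V₀ V₁ hst (hw4 i)).symm
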